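/- Let $p$ be a prime and let $V$ be a finite set with $n = |V| \ge 13$. An $\mathbb{F}_p$-labeled hypergraph on $V$ is a pair $G = (V,\lambda)$ with $\lambda \colon \mathcal{P}(V)\setminus\{\emptyset\} \to \mathbb{F}_p$. Its automorphism group $\mathrm{Aut}(G)$ is the group of all permutations $\pi \in \mathrm{Sym}(V)$ with $\lambda(\pi(e)) = \lambda(e)$ for all nonempty $e \subseteq V$. A subset $C \subseteq V$ is called fully symmetric in $G$ if $\lambda(e_1) = \lambda(e_2)$ for all nonempty $e_1, e_2 \subseteq V$ with $|e_1| = |e_2|$ and $e_1 \cap (V\setminus C) = e_2 \cap (V \setminus C)$. Let $0 < \varepsilon < 1/8$ be a real number and let $G$ be an $\mathbb{F}_p$-labeled hypergraph on $V$. Then at least one of the following holds: (1) there is a fully symmetric subset $C \subseteq V$ of $G$ with $|C| \ge n - \lfloor \varepsilon n \rfloor$; (2) the index of $\mathrm{Aut}(G)$ in $\mathrm{Sym}(V)$ satisfies $|\mathrm{Sym}(V)/\mathrm{Aut}(G)| > 2^{\lfloor \varepsilon n \rfloor}$. -/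

import Mathlib

/-- An `𝔽_p`-labeled hypergraph on the vertex set `V`: a label in `𝔽_p` for every
nonempty set of vertices. -/
@[ext]
structure LabeledHypergraph (p : ℕ) (V : Type*) where
  label : {e : Finset V // e.Nonempty} → ZMod p

namespace LabeledHypergraph

/-- The image `π(e)` of a nonempty vertex set under a permutation of the vertices. -/
def mapEdge {V : Type*} (π : Equiv.Perm V) (e : {e : Finset V // e.Nonempty}) :
    {e : Finset V // e.Nonempty} :=
  ⟨e.1.map π.toEmbedding, e.2.map⟩

/-- The action of `Sym(V)` on labeled hypergraphs: `(π • G).label e = G.label (π⁻¹(e))`. -/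
instance {p : ℕ} {V : Type*} : MulAction (Equiv.Perm V) (LabeledHypergraph p V) where
  smul π G := ⟨fun e => G.label (mapEdge π⁻¹ e)⟩
  one_smul G := by
    refine LabeledHypergraph.ext (funext fun e => congrArg G.label (Subtype.ext ?_))
    ext x
    simp [mapEdge]
    rfl
  mul_smul π σ G := by
    refine LabeledHypergraph.ext (funext fun e => congrArg G.label (Subtype.ext ?_))
    ext x
    simp [mapEdge]
    rfl

/-- The automorphism group of `G`: the permutations `π` of the vertices with `π • G = G`. -/
def aut {p : ℕ} {V : Type*} (G : LabeledHypergraph p V) : Subgroup (Equiv.Perm V) :=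
  MulAction.stabilizer (Equiv.Perm V) G

/-- `C` is fully symmetric in `G`: two (nonempty) vertex sets of the same size that agree
outside `C` have the same label. -/
def FullySymmetric {p : ℕ} {V : Type*} [Fintype V] [DecidableEq V]
    (G : LabeledHypergraph p V) (C : Finset V) : Prop :=
  ∀ e₁ e₂ : {e : Finset V // e.Nonempty},
    e₁.1.card = e₂.1.card → e₁.1 ∩ Cᶜ = e₂.1 ∩ Cᶜ → G.label e₁ = G.label e₂

end LabeledHypergraph

/-! Let `H = Aut(G)` have index at most `2 ^ k`, `k = ⌊εn⌋`. Lying in a common transposition of `H`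
is an equivalence relation, and each class is fully symmetric, so a class of at least `n - k` points
suffices. Bochert's commutator argument (`card_le_of_forall_swap_notMem`) leaves at most `2k + 2`
classes; it needs three-cycles in `H` to yield transpositions, which holds for hypergraphs. A union
of classes with more than `k` non-representatives omits at most `k` points, as otherwise a binomial
count of cosets exceeds `2 ^ k` (`two_pow_lt_index_of_saturated`). If no single class is that large,
a minimal such union is too small to omit only `k` points. -/

/-- Elements that are pairwise inequivalent modulo `H` bound the index of `H` from below. -/
theorem Subgroup.card_le_card_quotient {α ι : Type*} [Group α] [Finite α] (H : Subgroup α)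
    (f : ι → α) (hf : ∀ i j, (f i)⁻¹ * f j ∈ H → i = j) : Nat.card ι ≤ Nat.card (α ⧸ H) :=
  Nat.card_le_card_of_injective (fun i => (f i : α ⧸ H))
    fun i j h => hf i j (QuotientGroup.eq.1 h)

/-! ### Subgroups of the symmetric group of small index -/

namespace Equiv.Perm

variable {V : Type*} [DecidableEq V]

theorem swap_mem_trans {H : Subgroup (Equiv.Perm V)} {a b c : V} (hab : swap a b ∈ H)
    (hbc : swap b c ∈ H) : swap a c ∈ H := by
  by_cases h1 : a = b
  · rwa [h1]
  by_cases h2 : a = c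
  · rw [h2, swap_self]; exact H.one_mem
  by_cases h3 : c = b
  · rwa [h3]
  have h : swap a b * swap b c * (swap a b)⁻¹ = swap a c := by
    rw [← Equiv.swap_apply_apply, swap_apply_right, swap_apply_of_ne_of_ne (Ne.symm h2) h3]
  rw [← h]
  exact H.mul_mem (H.mul_mem hab hbc) (H.inv_mem hab)

/-- By conjugation, elements of `H` permute the classes of the relation `swap a b ∈ H`. -/
theorem swap_mem_apply {H : Subgroup (Equiv.Perm V)} {a b : V} {g : Equiv.Perm V} (hg : g ∈ H)
    (hab : swap a b ∈ H) : swap (g a) (g b) ∈ H := by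
  rw [Equiv.swap_apply_apply]
  exact H.mul_mem (H.mul_mem hg hab) (H.inv_mem hg)

/-- Any two subsets of `U` of equal size are related by a permutation fixing `Uᶜ` pointwise. -/
theorem exists_map_eq_of_subset [Fintype V] {U X Z : Finset V} (hX : X ⊆ U) (hZ : Z ⊆ U)
    (h : X.card = Z.card) :
    ∃ σ : Equiv.Perm V, (∀ x ∉ U, σ x = x) ∧ X.map σ.toEmbedding = Z := by
  have hc : (X.subtype (· ∈ U)).card = (Z.subtype (· ∈ U)).card := by
    rw [Finset.card_subtype, Finset.card_subtype, Finset.filter_true_of_mem fun x hx => hX hx,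
      Finset.filter_true_of_mem fun x hx => hZ hx, h]
  let e := Finset.equivOfCardEq hc
  refine ⟨ofSubtype (Equiv.extendSubtype e), fun x hx => ofSubtype_apply_of_not_mem _ hx, ?_⟩
  refine Finset.eq_of_subset_of_card_le ?_ (by simp [h])
  intro y hy
  obtain ⟨x, hx, rfl⟩ := Finset.mem_map.1 hy
  have h1 : (⟨x, hX hx⟩ : {x // x ∈ U}) ∈ X.subtype (· ∈ U) := by simpa using hx
  have h2 := Equiv.extendSubtype_mem e _ h1
  rw [Finset.mem_subtype] at h2
  simpa [ofSubtype_apply_of_mem _ (hX hx)] using h2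

/-- If the supports of `x` and `y` meet only in `a`, then the commutator acts as the three-cycle
`a ↦ x a ↦ y a ↦ a`. -/
theorem commutator_apply {x y : Equiv.Perm V} {a : V} (hx : x a ≠ a) (hy : y a ≠ a)
    (h : ∀ b, x b ≠ b → y b ≠ b → b = a) :
    x * y * x⁻¹ * y⁻¹ = swap a (y a) * swap a (x a) := by
  rw [mul_inv_eq_iff_eq_mul, mul_inv_eq_iff_eq_mul]
  ext b
  have hyx : y (x a) = x a := by_contra fun hc => hx (h _ (fun h' => hx (x.injective h')) hc)
  have hxy : x (y a) = y a := by_contra fun hc => hy (h _ hc fun h' => hy (y.injective h'))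
  have hne : x a ≠ y a := fun hc => hx (x.injective (by rw [hc, hxy]))
  simp only [Equiv.Perm.mul_apply]
  by_cases hba : b = a
  · rw [hba, hxy, hyx, swap_apply_right, swap_apply_left]
  by_cases hxb : x b = b
  · rw [hxb]
    by_cases hyb : y b = a
    · rw [hyb, swap_apply_left, swap_apply_of_ne_of_ne hx hne]
    · have h1 : y b ≠ x a := fun hc => by
        rw [← hyx] at hc
        rw [y.injective hc] at hxb
        exact hx (x.injective hxb)
      rw [swap_apply_of_ne_of_ne hyb h1,
        swap_apply_of_ne_of_ne hyb fun hc => hba (y.injective hc)]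
      by_contra hc
      exact hyb (h _ hc fun h' => hc (by rw [y.injective h', hxb]))
  · have hyb : y b = b := by_contra fun hc => hba (h b hxb hc)
    rw [hyb]
    by_cases hxa : x b = a
    · rw [hxa, swap_apply_of_ne_of_ne hy hne.symm, swap_apply_right]
    · have h1 : y (x b) = x b :=
        by_contra fun hc => hxa (h _ (fun h' => hxb (x.injective h')) hc)
      have h2 : x b ≠ y a := fun hc => by
        rw [← hxy] at hc
        rw [x.injective hc] at hyb
        exact hy (y.injective hyb)
      rw [h1, swap_apply_of_ne_of_ne hxa fun hc => hba (x.injective hc),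
        swap_apply_of_ne_of_ne hxa h2]

/-- If no nontrivial element of `H` is supported in `Γ`, then `H` has index at least `|Γ|!`. -/
theorem factorial_card_le_index [Fintype V] (H : Subgroup (Equiv.Perm V)) (Γ : Finset V)
    (h : ∀ g ∈ H, (∀ x ∉ Γ, g x = x) → g = 1) :
    Γ.card.factorial ≤ Nat.card (Equiv.Perm V ⧸ H) := by
  have := H.card_le_card_quotient (fun σ : Equiv.Perm {x // x ∈ Γ} => ofSubtype σ) (by
    intro σ τ hστ
    rw [← map_inv, ← map_mul] at hστ
    have := h _ hστ fun x hx => ofSubtype_apply_of_not_mem _ hx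
    have := ofSubtype_injective (this.trans (map_one _).symm)
    exact inv_mul_eq_one.1 this)
  simpa [Nat.card_eq_fintype_card, Fintype.card_perm] using this

/-- Bochert's argument: if three-cycles of `H` give transpositions of `H` and no transposition of
`H` lies in `T`, then a subgroup of index at most `2 ^ k` forces `T` to be small. -/
theorem card_le_of_forall_swap_notMem [Fintype V] {H : Subgroup (Equiv.Perm V)} {k : ℕ}
    (hH : Nat.card (Equiv.Perm V ⧸ H) ≤ 2 ^ k)
    (hthree : ∀ a b c : V, a ≠ b → a ≠ c → b ≠ c → swap a b * swap a c ∈ H → swap a b ∈ H)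
    (T : Finset V) (hT : ∀ a ∈ T, ∀ b ∈ T, swap a b ∈ H → a = b) :
    T.card ≤ 2 * k + 2 := by
  -- Otherwise the index is at least `(k + 2)! ≥ 2 ^ (k + 1) > 2 ^ k`.
  have key : ∀ Γ : Finset V, (∀ g ∈ H, (∀ x ∉ Γ, g x = x) → g = 1) → Γ.card ≤ k + 1 := by
    intro Γ hΓ
    by_contra! hc
    have h1 := factorial_card_le_index H Γ hΓ
    have h2 := Nat.factorial_mul_pow_le_factorial (m := 1) (n := k + 1)
    have h3 := Nat.factorial_le (show k + 2 ≤ Γ.card by omega)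
    rw [Nat.factorial_one, one_mul, one_add_one_eq_two,
      show 1 + (k + 1) = k + 2 by ring] at h2
    have h4 : 2 ^ k < 2 ^ (k + 1) := Nat.pow_lt_pow_right (by norm_num) (by omega)
    omega
  classical
  obtain ⟨Γ, hΓ⟩ := (T.powerset.filter fun Γ => ∀ g ∈ H, (∀ x ∉ Γ, g x = x) → g = 1).exists_maximal
    ⟨∅, by simp [Equiv.ext_iff]⟩
  have hΓm : Γ ⊆ T ∧ ∀ g ∈ H, (∀ x ∉ Γ, g x = x) → g = 1 := by
    simpa only [Finset.mem_filter, Finset.mem_powerset] using hΓ.1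
  have h1 := key Γ hΓm.2
  -- If `x ∈ H` is supported in `T \ Γ` and moves `a`, maximality of `Γ` gives `y ∈ H` supported in
  -- `insert a Γ` that moves `a`. The supports meet only in `a`, so their commutator is a
  -- three-cycle, and `H` contains a transposition inside `T`.
  have h2 := key (T \ Γ) (by
    intro x hxH hx
    by_contra hx1
    obtain ⟨a, ha⟩ : ∃ a, x a ≠ a := by
      by_contra! hc; exact hx1 (Equiv.ext hc)
    have haT : a ∈ T \ Γ := by
      by_contra hc; exact ha (hx a hc)
    obtain ⟨haT, haΓ⟩ := Finset.mem_sdiff.1 haT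
    obtain ⟨y, hyH, hy, hy1⟩ : ∃ y ∈ H, (∀ z ∉ insert a Γ, y z = z) ∧ y ≠ 1 := by
      by_contra! hc
      have := hΓ.2 (y := insert a Γ) (Finset.mem_filter.2 ⟨Finset.mem_powerset.2
        (Finset.insert_subset haT hΓm.1), hc⟩) (Finset.subset_insert _ _)
      exact haΓ (this (Finset.mem_insert_self _ _))
    have hya : y a ≠ a := by
      intro hc
      refine hy1 (hΓm.2 y hyH fun z hz => ?_)
      by_cases hza : z = a
      · rw [hza, hc]
      · exact hy z (by simp [hza, hz])
    have hxy : ∀ b, x b ≠ b → y b ≠ b → b = a := by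
      intro b hb hb'
      have hb1 : b ∈ T \ Γ := by_contra fun hc => hb (hx b hc)
      have hb2 : b ∈ insert a Γ := by_contra fun hc => hb' (hy b hc)
      rcases Finset.mem_insert.1 hb2 with h | h
      · exact h
      · exact absurd h (Finset.mem_sdiff.1 hb1).2
    have hxa : x a ≠ y a := by
      intro hc
      exact ha (hxy (x a) (fun h => ha (x.injective h))
        (fun h => hya (y.injective (by rw [← hc, h]))))
    have hmem : swap a (x a) * swap a (y a) ∈ H := by
      rw [← commutator_apply hya ha fun b h h' => hxy b h' h]
      exact H.mul_mem (H.mul_mem (H.mul_mem hyH hxH) (H.inv_mem hyH)) (H.inv_mem hxH)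
    have hs := hthree a (x a) (y a) ha.symm hya.symm hxa hmem
    have hxaT : x a ∈ T := by
      by_contra hc
      exact ha (x.injective (hx (x a) fun h => hc (Finset.mem_sdiff.1 h).1))
    exact ha (hT a haT _ hxaT hs).symm)
  have h3 := Finset.card_sdiff_add_card_eq_card hΓm.1
  omega

/-- A union `A = r ⁻¹' Q` of classes of the relation `swap a b ∈ H`, with more than `k`
non-representatives and a complement with more than `k` elements, forces large index. -/
theorem two_pow_lt_index_of_saturated [Fintype V] {H : Subgroup (Equiv.Perm V)} {k : ℕ} {r : V → V}
    (hr : ∀ x, swap (r x) x ∈ H) (hr' : ∀ x y, swap x y ∈ H → r x = r y) (Q : Finset V)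
    (hQ : k + 1 ≤ (Finset.univ.filter fun x => r x ∈ Q ∧ r x ≠ x).card)
    (hQ' : k + 1 ≤ (Finset.univ.filter fun x => r x ∉ Q).card) :
    2 ^ k < Nat.card (Equiv.Perm V ⧸ H) := by
  obtain ⟨X, hXs, hX⟩ := Finset.exists_subset_card_eq hQ
  obtain ⟨Y, hYs, hY⟩ := Finset.exists_subset_card_eq hQ'
  have hXm : ∀ x ∈ X, r x ∈ Q ∧ r x ≠ x := fun x hx => by simpa using hXs hx
  have hYm : ∀ y ∈ Y, r y ∉ Q := fun y hy => by simpa using hYs hy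
  have hrr : ∀ x, r (r x) = r x := fun x => hr' _ _ (hr x)
  have hdisj : _root_.Disjoint X Y := Finset.disjoint_left.2 fun x hx hy => hYm x hy (hXm x hx).1
  -- The representative of `x ∈ X` lies outside `X ∪ Y`, so `g` fixes it and keeps `x` in its class,
  -- hence out of `Y`.
  have hinv : ∀ g ∈ H, (∀ x ∉ X ∪ Y, g x = x) → X.map g.toEmbedding = X := by
    intro g hg hfix
    refine Finset.eq_of_subset_of_card_le ?_ (by simp)
    intro y hy
    obtain ⟨x, hx, rfl⟩ := Finset.mem_map.1 hy
    change g x ∈ X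
    have h1 : g (r x) = r x := hfix _ fun h => by
      rcases Finset.mem_union.1 h with h | h
      · exact (hXm _ h).2 (hrr x)
      · exact hYm _ h (by rw [hrr]; exact (hXm x hx).1)
    have h2 : r (g x) = r x := by
      have := hr' _ _ (swap_mem_apply hg (hr x))
      rw [h1, hrr] at this
      exact this.symm
    by_contra hc
    have h3 : g x ∉ X ∪ Y := fun h => (Finset.mem_union.1 h).elim hc fun h =>
      hYm _ h (by rw [h2]; exact (hXm x hx).1)
    rw [g.injective (hfix _ h3)] at hc
    exact hc hx
  have hex : ∀ Z : {Z // Z ∈ (X ∪ Y).powersetCard (k + 1)}, ∃ σ : Equiv.Perm V,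
      (∀ x ∉ X ∪ Y, σ x = x) ∧ X.map σ.toEmbedding = Z.1 := fun Z =>
    exists_map_eq_of_subset Finset.subset_union_left (Finset.mem_powersetCard.1 Z.2).1
      (hX.trans (Finset.mem_powersetCard.1 Z.2).2.symm)
  choose σ hσ hσX using hex
  have hcard := H.card_le_card_quotient σ (by
    intro Z W hZW
    have h1 := hinv _ hZW fun x hx => by
      rw [Equiv.Perm.mul_apply, hσ W x hx, Equiv.Perm.inv_eq_iff_eq, hσ Z x hx]
    refine Subtype.ext ?_
    rw [← hσX Z, ← hσX W]
    conv_lhs => rw [← h1]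
    rw [Finset.map_map]
    congr 1
    ext x
    simp)
  rw [Nat.card_eq_fintype_card, Fintype.card_coe, Finset.card_powersetCard,
    Finset.card_union_of_disjoint hdisj, hX, hY, ← two_mul] at hcard
  refine lt_of_lt_of_le ?_ hcard
  -- Since `2(k + 1) ≤ 2 ^ (k + 1)`, the central binomial coefficient is at least `2 ^ (k + 1)`.
  have h1 := Nat.four_pow_le_two_mul_self_mul_centralBinom (k + 1) (by omega)
  have h2 : 2 * (k + 1) ≤ 2 ^ (k + 1) := by
    have := Nat.lt_two_pow_self (n := k)
    rw [pow_succ]; omega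
  rw [Nat.centralBinom] at h1
  have h3 : (2 ^ (k + 1)) * 2 ^ (k + 1) ≤ 2 ^ (k + 1) * (2 * (k + 1)).choose (k + 1) := by
    rw [← mul_pow]
    exact h1.trans (Nat.mul_le_mul_right _ h2)
  have h4 := Nat.le_of_mul_le_mul_left h3 (by positivity)
  exact lt_of_lt_of_le (Nat.pow_lt_pow_right (by norm_num) (by omega)) h4

/-- A subgroup of index at most `2 ^ k` in which three-cycles give transpositions contains all
transpositions of some set omitting at most `k` points. -/
theorem exists_forall_swap_mem [Fintype V] {H : Subgroup (Equiv.Perm V)} {k : ℕ}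
    (hn : 5 * k + 3 ≤ Fintype.card V) (hH : Nat.card (Equiv.Perm V ⧸ H) ≤ 2 ^ k)
    (hthree : ∀ a b c : V, a ≠ b → a ≠ c → b ≠ c → swap a b * swap a c ∈ H → swap a b ∈ H) :
    ∃ C : Finset V, (∀ a ∈ C, ∀ b ∈ C, swap a b ∈ H) ∧ Fintype.card V - k ≤ C.card := by
  classical
  let s : Setoid V := ⟨fun a b => swap a b ∈ H, fun a => by rw [swap_self]; exact H.one_mem,
    fun {a b} h => by rwa [swap_comm], fun h h' => swap_mem_trans h h'⟩
  let r : V → V := fun x => (Quotient.mk s x).out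
  have hr : ∀ x, swap (r x) x ∈ H := fun x => Quotient.mk_out (s := s) x
  have hr' : ∀ x y, swap x y ∈ H → r x = r y := fun x y h =>
    congrArg Quotient.out (Quotient.sound (s := s) h)
  have hrr : ∀ x, r (r x) = r x := fun x => hr' _ _ (hr x)
  have hT := card_le_of_forall_swap_notMem hH hthree (Finset.univ.filter fun x => r x = x) (by
    intro a ha b hb hab
    simp only [Finset.mem_filter, Finset.mem_univ, true_and] at ha hb
    rw [← ha, ← hb, hr' a b hab])
  let F : Finset V → Finset V := fun Q => Finset.univ.filter fun x => r x ∈ Q ∧ r x ≠ x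
  have hsat : ∀ Q : Finset V, k + 1 ≤ (F Q).card →
      Fintype.card V ≤ (Finset.univ.filter fun x => r x ∈ Q).card + k := by
    intro Q hQ
    by_contra! hc
    have h1 := Finset.card_filter_add_card_filter_not (s := (Finset.univ : Finset V))
      (fun x => r x ∈ Q)
    rw [Finset.card_univ] at h1
    exact absurd hH (not_le.2 (two_pow_lt_index_of_saturated hr hr' Q hQ (by omega)))
  by_cases hbig : ∃ q, k + 1 ≤ (F {q}).card
  · obtain ⟨q, hq⟩ := hbig
    refine ⟨_, ?_, Nat.sub_le_iff_le_add.2 (hsat {q} hq)⟩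
    intro a ha b hb
    simp only [Finset.mem_filter, Finset.mem_univ, true_and, Finset.mem_singleton] at ha hb
    have h1 := hr a
    have h2 := hr b
    rw [ha, swap_comm] at h1
    rw [hb] at h2
    exact swap_mem_trans h1 h2
  push Not at hbig
  exfalso
  have hle : ∀ Q : Finset V, (Finset.univ.filter fun x => r x ∈ Q).card ≤
      (F Q).card + (2 * k + 2) := by
    intro Q
    refine le_trans (Finset.card_le_card ?_)
      ((Finset.card_union_le _ _).trans (Nat.add_le_add_left hT (F Q).card))
    intro x hx
    by_cases h : r x = x <;> simp_all [F]
  obtain ⟨Q, hQ⟩ := ((Finset.univ : Finset (Finset V)).filter fun Q =>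
    k + 1 ≤ (F Q).card).exists_minimal ⟨Finset.univ, by
      have := hle Finset.univ
      simp only [Finset.mem_univ, Finset.filter_true, Finset.card_univ] at this
      simp only [Finset.mem_filter, Finset.mem_univ, true_and]
      omega⟩
  have hQm : k + 1 ≤ (F Q).card := (Finset.mem_filter.1 hQ.1).2
  have hne : Q.Nonempty := by
    by_contra hc
    rw [Finset.not_nonempty_iff_eq_empty] at hc
    simp [F, hc] at hQm
  obtain ⟨q, hq⟩ := hne
  have h1 : (F (Q.erase q)).card ≤ k := by
    by_contra! hc
    have := hQ.2 (y := Q.erase q) (Finset.mem_filter.2 ⟨Finset.mem_univ _, hc⟩)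
      (Finset.erase_subset _ _)
    exact Finset.notMem_erase q Q (this hq)
  have h2 : (F Q).card ≤ (F (Q.erase q)).card + (F {q}).card := by
    refine le_trans (Finset.card_le_card ?_) (Finset.card_union_le _ _)
    intro x hx
    by_cases h : r x = q <;> simp_all [F]
  have h3 := hbig q
  have h4 := hle Q
  have h5 := hsat Q hQm
  -- Minimality bounds `F Q` by `k + k`, so `Q` covers at most `4k + 2` points and `n ≤ 5k + 2`.
  omega

end Equiv.Perm

/-! ### Automorphisms of labeled hypergraphs -/

namespace LabeledHypergraph

variable {p : ℕ} {V : Type*}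

theorem mem_aut_iff {G : LabeledHypergraph p V} {π : Equiv.Perm V} :
    π ∈ G.aut ↔ ∀ e, G.label (mapEdge π e) = G.label e := by
  have key : ∀ π : Equiv.Perm V, π ∈ G.aut → ∀ e, G.label (mapEdge π⁻¹ e) = G.label e :=
    fun π h e => congrFun (congrArg label (MulAction.mem_stabilizer_iff.1 h)) e
  constructor
  · intro h
    simpa using key π⁻¹ (G.aut.inv_mem h)
  · intro h
    rw [← inv_mem_iff]
    refine MulAction.mem_stabilizer_iff.2 (LabeledHypergraph.ext (funext fun e => ?_))
    change G.label (mapEdge π⁻¹⁻¹ e) = _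
    rw [inv_inv, h]

variable [DecidableEq V]

/-- A set all of whose transpositions are automorphisms is fully symmetric. -/
theorem fullySymmetric_of_forall_swap_mem [Fintype V] {G : LabeledHypergraph p V} {C : Finset V}
    (h : ∀ a ∈ C, ∀ b ∈ C, Equiv.swap a b ∈ G.aut) : G.FullySymmetric C := by
  -- Swapping some `a ∈ e₁ \ e₂` with some `b ∈ e₂ \ e₁`, both in `C`, lowers the size of the
  -- difference by one.
  have key : ∀ m : ℕ, ∀ e₁ e₂ : {e : Finset V // e.Nonempty}, (e₁.1 \ e₂.1).card = m →
      e₁.1.card = e₂.1.card → e₁.1 ∩ Cᶜ = e₂.1 ∩ Cᶜ → G.label e₁ = G.label e₂ := by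
    intro m
    induction m with
    | zero =>
      intro e₁ e₂ hm hc _
      rw [Finset.card_eq_zero, Finset.sdiff_eq_empty_iff_subset] at hm
      exact congrArg _ (Subtype.ext (Finset.eq_of_subset_of_card_le hm hc.ge))
    | succ m ih =>
      intro e₁ e₂ hm hc hC
      have hm' : (e₂.1 \ e₁.1).card = m + 1 := by
        rw [← hm]; exact (Finset.card_sdiff_comm hc).symm
      obtain ⟨a, ha⟩ := Finset.card_pos.1 (by omega : 0 < (e₁.1 \ e₂.1).card)
      obtain ⟨b, hb⟩ := Finset.card_pos.1 (by omega : 0 < (e₂.1 \ e₁.1).card)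
      rw [Finset.mem_sdiff] at ha hb
      have hC' : ∀ x ∉ C, (x ∈ e₁.1 ↔ x ∈ e₂.1) := fun x hx => by
        have := Finset.ext_iff.1 hC x
        simpa [hx] using this
      have haC : a ∈ C := by_contra fun hx => ha.2 ((hC' a hx).1 ha.1)
      have hbC : b ∈ C := by_contra fun hx => hb.2 ((hC' b hx).2 hb.1)
      have hmem : ∀ x, x ∈ (mapEdge (Equiv.swap a b) e₁).1 ↔ Equiv.swap a b x ∈ e₁.1 := by
        intro x
        simp [mapEdge, Finset.mem_map_equiv]
      have hval : ∀ x, x ∈ (mapEdge (Equiv.swap a b) e₁).1 ↔ x = b ∨ (x ∈ e₁.1 ∧ x ≠ a) := by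
        intro x
        rw [hmem]
        by_cases hxa : x = a
        · subst hxa
          simp only [Equiv.swap_apply_left]
          grind
        by_cases hxb : x = b
        · subst hxb
          simp [ha.1]
        rw [Equiv.swap_apply_of_ne_of_ne hxa hxb]
        simp [hxa, hxb]
      rw [← mem_aut_iff.1 (h a haC b hbC) e₁]
      refine ih _ e₂ ?_ (by simpa [mapEdge] using hc) ?_
      · have : (mapEdge (Equiv.swap a b) e₁).1 \ e₂.1 = (e₁.1 \ e₂.1).erase a := by
          ext x
          rw [Finset.mem_sdiff, hval, Finset.mem_erase, Finset.mem_sdiff]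
          grind
        rw [this, Finset.card_erase_of_mem (Finset.mem_sdiff.2 ha), hm]
        rfl
      · ext x
        rw [Finset.mem_inter, hval, Finset.mem_compl, Finset.mem_inter, Finset.mem_compl]
        have := hC' x
        grind
  exact fun e₁ e₂ => key _ e₁ e₂ rfl

/-- A three-cycle is transitive on the subsets of given size of its support, so together with it
the automorphism group contains the transpositions of the support. -/
theorem swap_mem_aut_of_threeCycle_mem_aut {G : LabeledHypergraph p V} {a b c : V} (hab : a ≠ b)
    (hac : a ≠ c) (hbc : b ≠ c) (h : Equiv.swap a b * Equiv.swap a c ∈ G.aut) :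
    Equiv.swap a b ∈ G.aut := by
  rw [mem_aut_iff]
  intro e
  set π := Equiv.swap a b * Equiv.swap a c with hπ
  have h1 := mem_aut_iff.1 h
  have h2 := mem_aut_iff.1 (G.aut.mul_mem h h)
  have hcases : mapEdge (Equiv.swap a b) e = e ∨ mapEdge (Equiv.swap a b) e = mapEdge π e ∨
      mapEdge (Equiv.swap a b) e = mapEdge (π * π) e := by
    have hext : ∀ σ τ : Equiv.Perm V, (∀ x, σ⁻¹ x ∈ e.1 ↔ τ⁻¹ x ∈ e.1) →
        mapEdge σ e = mapEdge τ e := fun σ τ hστ =>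
      Subtype.ext (Finset.ext fun x => by simpa [mapEdge, Finset.mem_map_equiv] using hστ x)
    have he : e = mapEdge 1 e := Subtype.ext (Finset.ext fun x => by
      simp [mapEdge, ← Equiv.Perm.inv_def, Finset.mem_map_equiv])
    have hb' : Equiv.swap a c b = b := Equiv.swap_apply_of_ne_of_ne hab.symm hbc
    have hc' : Equiv.swap a b c = c := Equiv.swap_apply_of_ne_of_ne hac.symm hbc.symm
    have hx : ∀ x, x = a ∨ x = b ∨ x = c ∨ (Equiv.swap a b x = x ∧ Equiv.swap a c x = x) := by
      intro x
      simp only [Equiv.swap_apply_def]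
      grind
    -- If `e` does not separate `a` and `b`, the swap fixes `e`. Otherwise `c` sides with `a` or
    -- with `b`, and the swap acts on `e` as `π` or as `π * π` respectively.
    by_cases ha : a ∈ e.1 ↔ b ∈ e.1
    · left
      conv_rhs => rw [he]
      apply hext
      intro x
      simp only [Equiv.swap_inv, inv_one, Equiv.Perm.one_apply, Equiv.swap_apply_def]
      grind
    · right
      by_cases hc : c ∈ e.1 ↔ a ∈ e.1
      · left
        apply hext
        intro x
        simp only [hπ, mul_inv_rev, Equiv.swap_inv, Equiv.Perm.mul_apply]
        rcases hx x with rfl | rfl | rfl | ⟨hx₁, hx₂⟩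
        · simp only [Equiv.swap_apply_left, hb']
        · simp only [Equiv.swap_apply_left, Equiv.swap_apply_right]; tauto
        · simp only [Equiv.swap_apply_right, hc']; tauto
        · simp only [hx₁, hx₂]
      · right
        apply hext
        intro x
        simp only [hπ, mul_inv_rev, Equiv.swap_inv, Equiv.Perm.mul_apply]
        rcases hx x with rfl | rfl | rfl | ⟨hx₁, hx₂⟩
        · simp only [Equiv.swap_apply_left, Equiv.swap_apply_right, hb']; tauto
        · simp only [Equiv.swap_apply_left, Equiv.swap_apply_right, hc']
        · simp only [Equiv.swap_apply_left, Equiv.swap_apply_right, hb', hc']; tauto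
        · simp only [hx₁, hx₂]
  rcases hcases with h' | h' | h'
  · rw [h']
  · rw [h', h1]
  · rw [h', h2]

end LabeledHypergraph

theorem mainTheorem5 {p : ℕ} [Fact p.Prime] {V : Type*} [Fintype V] [DecidableEq V]
    (ε : ℝ) (hε₀ : 0 < ε) (hε₁ : ε < 1 / 8)
    (hn : 13 ≤ Fintype.card V) (G : LabeledHypergraph p V) :
    (∃ C : Finset V, G.FullySymmetric C ∧
      Fintype.card V - ⌊ε * (Fintype.card V : ℝ)⌋₊ ≤ C.card) ∨
    2 ^ ⌊ε * (Fintype.card V : ℝ)⌋₊ < Nat.card (Equiv.Perm V ⧸ G.aut) := by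
  refine or_iff_not_imp_right.2 fun hH => ?_
  have hk : 8 * ⌊ε * (Fintype.card V : ℝ)⌋₊ < Fintype.card V := by
    have h0 : (13 : ℝ) ≤ Fintype.card V := by exact_mod_cast hn
    have h1 := Nat.floor_le (show 0 ≤ ε * (Fintype.card V : ℝ) by positivity)
    have h2 : ε * (Fintype.card V : ℝ) < 1 / 8 * (Fintype.card V : ℝ) :=
      mul_lt_mul_of_pos_right hε₁ (by linarith)
    have h3 : (8 : ℝ) * ⌊ε * (Fintype.card V : ℝ)⌋₊ < Fintype.card V := by linarith
    exact_mod_cast h3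
  -- `5k + 3 ≤ n` follows from `8k < n` when `k ≥ 1`, and from `13 ≤ n` when `k = 0`.
  obtain ⟨C, hC, hcard⟩ := Equiv.Perm.exists_forall_swap_mem (by omega) (not_lt.1 hH)
    fun a b c => LabeledHypergraph.swap_mem_aut_of_threeCycle_mem_aut (G := G)
  exact ⟨C, LabeledHypergraph.fullySymmetric_of_forall_swap_mem hC, hcard⟩
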